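/- Let $n$ and $k$ be non-negative integers. A permutation $p$ of $\{1,\dots,n\}$ contains a permutation $q$ of $\{1,\dots,k\}$ (as a pattern) if there are positions $1\le j_1<j_2<\dots<j_k\le n$ such that $p(j_1),\dots,p(j_k)$ are in the same relative order as $q(1),\dots,q(k)$, i.e. for all $a,b$, $p(j_a)<p(j_b)$ if and only if $q(a)<q(b)$; otherwise $p$ avoids $q$. Let $S_n(q)$ be the number of permutations of $\{1,\dots,n\}$ that avoid $q$, and let $1342$ denote the permutation $q$ of $\{1,2,3,4\}$ with $q(1)=1$, $q(2)=3$, $q(3)=4$, $q(4)=2$. Then for all integers $n\ge 0$, $$S_n(1342)=\frac{7n^2-3n-2}{2}\,(-1)^{n-1}+3\sum_{i=2}^{n}2^{i+1}\,\frac{(2i-4)!}{i!\,(i-2)!}\binom{n-i+2}{2}(-1)^{n-i},$$ where the sum is empty (equal to $0$) for $n<2$. -/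

import Mathlib

open scoped Nat

/-- The permutation `p` contains the pattern `q`: there are positions
`f 0 < f 1 < ... < f (k-1)` at which the entries of `p` are in the same relative order
as the entries of `q`. -/
def ContainsPattern {n k : ℕ} (p : Equiv.Perm (Fin n)) (q : Equiv.Perm (Fin k)) : Prop :=
  ∃ f : Fin k → Fin n, StrictMono f ∧ ∀ a b : Fin k, p (f a) < p (f b) ↔ q a < q b

/-- The permutation `p` avoids the pattern `q`. -/
def AvoidsPattern {n k : ℕ} (p : Equiv.Perm (Fin n)) (q : Equiv.Perm (Fin k)) : Prop :=
  ¬ ContainsPattern p q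

/-- `numAvoiding n q` is the number of permutations of length `n` that avoid `q`. -/
noncomputable def numAvoiding {k : ℕ} (n : ℕ) (q : Equiv.Perm (Fin k)) : ℕ :=
  Nat.card {p : Equiv.Perm (Fin n) // AvoidsPattern p q}

/-- The pattern 1342, written with the values 0, 1, 2, 3 in place of 1, 2, 3, 4. -/
def pattern1342 : Equiv.Perm (Fin 4) where
  toFun := ![0, 2, 3, 1]
  invFun := ![0, 3, 1, 2]
  left_inv := by decide
  right_inv := by decide

/-!
Inserting a new largest entry into a 1342-avoiding permutation at the cut `A | B` keeps it
1342-avoiding iff the cut is *active*: no pattern `132` has `1, 3` in `A` and `2` in `B`. Record the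
active cuts from left to right as a word of marks, `true` for the *skew* cuts (no entry of `B`
exceeds an entry of `A`) and `false` for the others. Insertion at the active cut number `i`
(from `0`) turns the word `w` into `true, false, …, false` (`i` times `false`) followed by the part
of `w` from position `i` on, from which the entries before the first `true` are dropped
(`marks_insert`). The reason is `exists_isSkew_between`: a cut to the right of the new entry stays
active iff a skew cut lies between the two. Hence the permutations of length `n` correspond to
`n`-step walks on words of marks (`numAvoiding_eq_length_walks`).

Call `true, false, …, false` a block. If a walk ends at `A ++ T`, where `T` is a nonempty concatenation
of blocks, cut it at its last visit to `T`. After that it never alters `T`, so it is a walk to `T`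
followed by a copy of a walk from `[true]` to `A ++ [true]` (`walkSum_splitSum`). Apply this to the
first block `A` of the end point of a nonempty walk. Let `F(x, u)` be the generating function by
number of steps and length of the end point, `S(x) = F(x, 1)`, and `B(x, u)` the generating function
of the walks to words `A ++ [true]` with `A` a single block, by the length of `A`. Weighting by the
total length gives `F - u = F B`. Weighting by the length of the first block gives
`x u (F - S) / (u - 1) = S B`, as that length takes each value from `1` to the length of the
previous word once. Therefore

  `S (F - u) (u - 1) = x u F (F - S)`   (`cutSeries_functional_equation`).

This equation has only one solution (`eq_of_functional_equation`). With the series `U` given by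
`(1 + x) U² - 3 U + 2 = 0`, `U(0) = 1`, and `c = 1 + u (U - 1) U⁻² c²`, the solution is
`F = U (U - (U - u) c)`, and `S = U² (2 - U)` (`exists_avoiderSeries_eq`). As
`D = 3 - 2 (1 + x) U` satisfies `D² = 1 - 8x`, this reads
`2 (1 + x)³ S = 1 + 20 x - 8 x² + (1 - 8x)^(3/2)` (`exists_sqrt_cube`), and the formula follows by
comparing coefficients.
-/

/-! ### Inserting the largest entry into a 1342-avoiding word -/

/-- The word `l` has no subsequence in the relative order `1342`. -/
def Avoids1342 (l : List ℕ) : Prop :=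
  ∀ a b c d, List.Sublist [a, b, c, d] l → ¬ (a < d ∧ d < b ∧ b < c)

/-- The cut `A | B` of the word `A ++ B` is active: no pattern `132` has its first two entries
in `A` and the last one in `B`, so that a new largest entry inserted here creates no `1342`. -/
def IsActive (A B : List ℕ) : Prop :=
  ∀ a c, List.Sublist [a, c] A → ∀ b ∈ B, ¬ (a < b ∧ b < c)

/-- The cut `A | B` is a skew cut: no entry of `B` exceeds an entry of `A`. -/
def IsSkew (A B : List ℕ) : Prop := ∀ a ∈ A, ∀ b ∈ B, b ≤ a

open Classical in
/-- The active cuts of `A ++ B` whose left part extends `A`, from left to right. -/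
noncomputable def activeCuts : List ℕ → List ℕ → List (List ℕ × List ℕ)
  | A, [] => [(A, [])]
  | A, b :: B => (if IsActive A (b :: B) then [(A, b :: B)] else []) ++ activeCuts (A ++ [b]) B

open Classical in
/-- The active cuts of `A ++ B` from `A | B` on, each one recorded by whether it is a skew cut. -/
noncomputable def marks : List ℕ → List ℕ → List Bool
  | A, [] => [decide (IsSkew A [])]
  | A, b :: B =>
    (if IsActive A (b :: B) then [decide (IsSkew A (b :: B))] else []) ++ marks (A ++ [b]) B

open Classical in
/-- The marks of the active cuts of `A ++ M ++ B` from `A` on and strictly before `A ++ M`. -/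
noncomputable def marksBefore : List ℕ → List ℕ → List ℕ → List Bool
  | _, [], _ => []
  | A, m :: M, B =>
    (if IsActive A (m :: M ++ B) then [decide (IsSkew A (m :: M ++ B))] else []) ++
      marksBefore (A ++ [m]) M B

lemma isActive_nil_right (A : List ℕ) : IsActive A [] := by
  intro a c _ b hb; simp at hb

lemma isSkew_nil_right (A : List ℕ) : IsSkew A [] := by
  intro a _ b hb; simp at hb

lemma isSkew_nil_left (B : List ℕ) : IsSkew [] B := by
  intro a ha; simp at ha

lemma IsSkew.isActive {A B : List ℕ} (h : IsSkew A B) : IsActive A B := by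
  intro a c hac b hb ⟨h1, _⟩
  have := h a (hac.subset (by simp)) b hb
  omega

lemma marks_append (A M B : List ℕ) :
    marks A (M ++ B) = marksBefore A M B ++ marks (A ++ M) B := by
  induction M generalizing A with
  | nil => simp [marksBefore]
  | cons m M ih =>
    rw [List.cons_append, marks, marksBefore, ih]
    simp

open Classical in
lemma marksBefore_append_singleton (A M B : List ℕ) (b : ℕ) :
    (marksBefore A (M ++ [b]) B).length =
      (marksBefore A M (b :: B)).length +
        if IsActive (A ++ M) (b :: B) then 1 else 0 := by
  induction M generalizing A with
  | nil =>
    simp only [List.nil_append, marksBefore, List.append_nil, List.cons_append, List.length_nil]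
    split_ifs <;> simp_all
  | cons m M ih =>
    have e₁ : m :: (M ++ [b]) ++ B = m :: M ++ b :: B := by simp
    have e₂ : A ++ [m] ++ M = A ++ m :: M := by simp
    rw [List.cons_append, marksBefore, marksBefore, List.length_append, List.length_append, ih,
      e₁, e₂, add_assoc]

lemma exists_isSkew_between {A M B : List ℕ} (hact : IsActive (A ++ M) B)
    (hB : ∀ a ∈ A, ∀ b ∈ B, b ≤ a) :
    ∃ M₁ M₂, M = M₁ ++ M₂ ∧ IsSkew (A ++ M₁) (M₂ ++ B) := by
  induction hn : M.length using Nat.strong_induction_on generalizing A M with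
  | _ n ih =>
  by_cases hs : IsSkew A (M ++ B)
  · exact ⟨[], M, rfl, by simpa using hs⟩
  · simp only [IsSkew, not_forall, not_le] at hs
    obtain ⟨a, ha, c, hc, hac⟩ := hs
    rcases List.mem_append.1 hc with hc | hc
    · obtain ⟨M₁, M₂, rfl⟩ := List.append_of_mem hc
      have key : ∀ a' ∈ A ++ M₁ ++ [c], ∀ b ∈ B, b ≤ a' := by
        intro x hx z hz
        have hza := hB a ha z hz
        simp only [List.mem_append, List.mem_singleton] at hx
        rcases hx with (hx | hx) | rfl
        · exact hB x hx z hz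
        · -- otherwise `x < z < c` would be a pattern `132` across the active cut
          by_contra hlt
          refine hact x c ?_ z hz ⟨by omega, by omega⟩
          have h1 : List.Sublist ([x] ++ [c]) (M₁ ++ c :: M₂) :=
            List.Sublist.append (List.singleton_sublist.2 hx)
              (List.singleton_sublist.2 (by simp))
          exact h1.trans (List.sublist_append_right _ _)
        · omega
      obtain ⟨N₁, N₂, rfl, h⟩ := ih M₂.length (by simp at hn; omega)
        (A := A ++ M₁ ++ [c]) (M := M₂) (by simpa using hact) key rfl
      exact ⟨M₁ ++ c :: N₁, N₂, by simp, by simpa using h⟩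
    · exact absurd (hB a ha c hc) (by omega)

section Insertion

variable {n : ℕ}

lemma isActive_insert_right {A M B : List ℕ} (hB : ∀ b ∈ B, b < n) :
    IsActive (A ++ n :: M) B ↔ IsActive (A ++ M) B ∧ ∀ a ∈ A, ∀ b ∈ B, b ≤ a := by
  constructor
  · intro h
    refine ⟨fun a c hac => h a c (hac.trans ?_), fun a ha b hb => ?_⟩
    · exact List.Sublist.append (List.Sublist.refl _) (List.sublist_cons_self _ _)
    · by_contra hlt
      refine h a n ?_ b hb ⟨by omega, hB b hb⟩
      exact List.Sublist.append (l₁ := [a]) (List.singleton_sublist.2 ha)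
        (List.singleton_sublist.2 (by simp))
  · rintro ⟨h1, h2⟩ a c hac b hb ⟨hab, hbc⟩
    have hbn := hB b hb
    obtain ⟨l₁, l₂, he, hl₁, hl₂⟩ := List.sublist_append_iff.1 hac
    by_cases hc : c = n
    · subst hc
      have haA : a ∈ A := by
        rcases l₁ with _ | ⟨x, l₁⟩
        · simp only [List.nil_append] at he
          subst he
          rcases List.sublist_cons_iff.1 hl₂ with hl | ⟨r, hr, hl⟩
          · exfalso
            exact h1 a c (hl.trans (List.sublist_append_right _ _)) b hb ⟨hab, hbc⟩
          · simp at hr; omega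
        · simp only [List.cons_append, List.cons.injEq] at he
          exact hl₁.subset (by simp [he.1])
      have := h2 a haA b hb
      omega
    · refine h1 a c ?_ b hb ⟨hab, hbc⟩
      have h3 : List.Sublist l₂ M := by
        rcases List.sublist_cons_iff.1 hl₂ with hl | ⟨r, rfl, hl⟩
        · exact hl
        · exfalso
          have : n ∈ [a, c] := by rw [he]; simp
          simp at this; omega
      rw [he]; exact hl₁.append h3

lemma isSkew_insert_right {A M B : List ℕ} (hB : ∀ b ∈ B, b < n) :
    IsSkew (A ++ n :: M) B ↔ IsSkew (A ++ M) B := by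
  constructor
  · intro h a ha
    refine h a ?_
    simp only [List.mem_append, List.mem_cons] at ha ⊢; tauto
  · intro h a ha b hb
    simp only [List.mem_append, List.mem_cons] at ha
    rcases ha with ha | rfl | ha
    · exact h a (by simp [ha]) b hb
    · exact (hB b hb).le
    · exact h a (by simp [ha]) b hb

lemma isActive_insert_left {A M B : List ℕ} (hA : ∀ a ∈ A, a < n) :
    IsActive A (M ++ n :: B) ↔ IsActive A (M ++ B) := by
  constructor
  · intro h a c hac b hb
    refine h a c hac b ?_
    simp only [List.mem_append, List.mem_cons] at hb ⊢; tauto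
  · intro h a c hac b hb
    simp only [List.mem_append, List.mem_cons] at hb
    rcases hb with hb | rfl | hb
    · exact h a c hac b (by simp [hb])
    · have := hA c (hac.subset (by simp)); omega
    · exact h a c hac b (by simp [hb])

lemma not_isSkew_insert_left {A M B : List ℕ} (hA : ∀ a ∈ A, a < n) (h0 : A ≠ []) :
    ¬ IsSkew A (M ++ n :: B) := by
  intro h
  obtain ⟨a, ha⟩ := List.exists_mem_of_ne_nil A h0
  have := h a ha n (by simp)
  have := hA a ha
  omega

lemma marks_insert_of_le {A M B : List ℕ} (hB : ∀ b ∈ B, b < n)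
    (h : ∀ a ∈ A, ∀ b ∈ B, b ≤ a) : marks (A ++ n :: M) B = marks (A ++ M) B := by
  induction B generalizing M with
  | nil => simp [marks, isSkew_nil_right]
  | cons b B ih =>
    have hact : IsActive (A ++ n :: M) (b :: B) ↔ IsActive (A ++ M) (b :: B) :=
      (isActive_insert_right hB).trans (and_iff_left h)
    have hskew := isSkew_insert_right (A := A) (M := M) hB
    have := ih (M := M ++ [b]) (fun x hx => hB x (by simp [hx]))
      (fun a ha x hx => h a ha x (by simp [hx]))
    rw [marks, marks]
    rw [← List.cons_append, ← List.append_assoc, ← List.append_assoc] at this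
    rw [this, propext hact, propext hskew]

/-- After the insertion of a new largest entry at `A |`, the active cuts to its right are the old
ones from the next skew cut on. -/
lemma marks_insert_right {A M B : List ℕ} (hB : ∀ b ∈ B, b < n)
    (hM : ∀ M₁ M₂, M = M₁ ++ M₂ → M₂ ≠ [] → ¬ IsSkew (A ++ M₁) (M₂ ++ B)) :
    marks (A ++ n :: M) B = (marks (A ++ M) B).dropWhile (fun b => !b) := by
  induction B generalizing M with
  | nil => simp [marks, isSkew_nil_right]
  | cons b B ih =>
    by_cases hs : IsSkew (A ++ M) (b :: B)
    · rw [marks_insert_of_le hB (fun a ha x hx => hs a (by simp [ha]) x hx), marks]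
      simp [hs, hs.isActive]
    · have ih' := ih (M := M ++ [b]) (fun x hx => hB x (by simp [hx])) (by
        intro M₁ M₂ h h2
        rcases List.eq_nil_or_concat M₂ with rfl | ⟨N, y, rfl⟩
        · exact absurd rfl h2
        · rw [List.concat_eq_append, ← List.append_assoc] at h
          obtain ⟨h3, h4⟩ := List.append_inj' h rfl
          obtain rfl : b = y := by simpa using h4
          by_cases hN : N = []
          · subst hN; simp at h3; subst h3; simpa using hs
          · simpa using hM M₁ N h3 hN)
      have hn : ¬ IsActive (A ++ n :: M) (b :: B) := by
        rw [isActive_insert_right hB]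
        rintro ⟨h1, h2⟩
        obtain ⟨M₁, M₂, rfl, h3⟩ := exists_isSkew_between h1 h2
        by_cases h4 : M₂ = []
        · subst h4; exact hs (by simpa using h3)
        · exact hM M₁ M₂ rfl h4 h3
      rw [marks, marks, if_neg hn, List.nil_append, List.append_assoc, List.cons_append, ih',
        ← List.append_assoc]
      by_cases ha : IsActive (A ++ M) (b :: B)
      · simp [ha, hs]
      · simp [ha]

lemma marksBefore_insert {A M B : List ℕ} (hA : ∀ a ∈ A, a < n) (hM : ∀ a ∈ M, a < n)
    (h0 : A ≠ []) :
    marksBefore A M (n :: B) = List.replicate (marksBefore A M B).length false := by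
  induction M generalizing A with
  | nil => simp [marksBefore]
  | cons m M ih =>
    rw [marksBefore, marksBefore, ih (by
      intro a ha
      simp only [List.mem_append, List.mem_singleton] at ha
      rcases ha with ha | rfl
      · exact hA a ha
      · exact hM _ (by simp)) (fun a ha => hM a (by simp [ha])) (by simp)]
    have h1 := isActive_insert_left (M := m :: M) (B := B) hA
    have h2 := not_isSkew_insert_left (M := m :: M) (B := B) hA h0
    by_cases ha : IsActive A (m :: M ++ B)
    · rw [if_pos ha, if_pos (h1.2 ha)]
      simp only [h2, decide_false]
      simp [List.replicate_succ]
    · rw [if_neg ha, if_neg (fun h => ha (h1.1 h))]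
      simp

lemma marks_insert {A B : List ℕ} (hA : ∀ a ∈ A, a < n) (hB : ∀ b ∈ B, b < n)
    (hact : IsActive A B) :
    marks [] (A ++ n :: B) = true :: List.replicate (marksBefore [] A B).length false ++
      (marks A B).dropWhile (fun b => !b) := by
  have hr := marks_insert_right (A := A) (M := []) hB (by simp)
  have hact' : IsActive A (n :: B) := by
    simpa using (isActive_insert_left (M := []) (B := B) hA).2 (by simpa using hact)
  rw [List.append_nil] at hr
  rw [marks_append, List.nil_append, marks, hr, if_pos hact', ← List.append_assoc]
  congr 1
  rcases A with _ | ⟨a, A⟩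
  · simp [marksBefore, isSkew_nil_left]
  · have h2 := not_isSkew_insert_left (M := []) (B := B) hA (by simp)
    simp only [List.nil_append] at h2
    rw [marksBefore, marksBefore, marksBefore_insert
      (fun x hx => hA x (by simp at hx; simp [hx])) (fun x hx => hA x (by simp [hx])) (by simp)]
    simp [h2, isSkew_nil_left, (isSkew_nil_left _).isActive, ← List.replicate_succ']

end Insertion

/-! ### The induced walk on marks -/

/-- The words of marks that arise from `w` by inserting a new largest entry at each active cut,
when `c` active cuts precede `w`. -/
def successorsFrom : ℕ → List Bool → List (List Bool)
  | _, [] => []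
  | c, s :: w =>
    (true :: List.replicate c false ++ (s :: w).dropWhile (fun b => !b)) :: successorsFrom (c + 1) w

lemma map_marks_insert {n : ℕ} {A B : List ℕ} (hA : ∀ a ∈ A, a < n) (hB : ∀ b ∈ B, b < n) :
    (activeCuts A B).map (fun c => marks [] (c.1 ++ n :: c.2)) =
      successorsFrom (marksBefore [] A B).length (marks A B) := by
  induction B generalizing A with
  | nil =>
    simp only [activeCuts, List.map_cons, List.map_nil]
    rw [marks_insert hA hB (isActive_nil_right A)]
    simp [marks, successorsFrom]
  | cons b B ih =>
    have ih' := ih (A := A ++ [b]) (by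
      intro a ha
      simp only [List.mem_append, List.mem_singleton] at ha
      rcases ha with ha | rfl
      · exact hA a ha
      · exact hB _ (by simp)) (fun x hx => hB x (by simp [hx]))
    have hlen := marksBefore_append_singleton [] A B b
    rw [List.nil_append] at hlen
    rw [activeCuts, List.map_append, ih', hlen]
    by_cases h : IsActive A (b :: B)
    · simp only [h, if_true, List.map_cons, List.map_nil]
      rw [marks_insert hA hB h]
      conv_rhs => rw [marks, if_pos h]
      rw [List.singleton_append, List.singleton_append, successorsFrom, marks, if_pos h,
        List.singleton_append]
    · simp only [h, if_false, List.map_nil, List.nil_append]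
      conv_rhs => rw [marks, if_neg h]
      simp

/-- The 1342-avoiding rearrangements of `0, …, n - 1`, built by successive insertion. -/
noncomputable def avoiders : ℕ → List (List ℕ)
  | 0 => [[]]
  | n + 1 => (avoiders n).flatMap fun l => (activeCuts [] l).map fun c => c.1 ++ n :: c.2

/-- The end points, with multiplicity, of the `n`-step walks on words of marks that start at the
word of the empty permutation. -/
def walks : ℕ → List (List Bool)
  | 0 => [[true]]
  | n + 1 => (walks n).flatMap (successorsFrom 0)

lemma mem_activeCuts {A B A' B' : List ℕ} :
    (A', B') ∈ activeCuts A B ↔ ∃ M, A' = A ++ M ∧ B = M ++ B' ∧ IsActive A' B' := by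
  induction B generalizing A with
  | nil =>
    simp only [activeCuts, List.mem_singleton, Prod.mk.injEq]
    constructor
    · rintro ⟨rfl, rfl⟩
      exact ⟨[], by simp, by simp, isActive_nil_right _⟩
    · rintro ⟨M, rfl, h, -⟩
      obtain ⟨rfl, rfl⟩ := List.append_eq_nil_iff.1 h.symm
      simp
  | cons b B ih =>
    rw [activeCuts, List.mem_append, ih]
    constructor
    · rintro (h | ⟨M, rfl, rfl, h⟩)
      · split_ifs at h with ha
        · simp only [List.mem_singleton, Prod.mk.injEq] at h
          obtain ⟨rfl, rfl⟩ := h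
          exact ⟨[], by simp, by simp, ha⟩
        · simp at h
      · exact ⟨b :: M, by simp, by simp, h⟩
    · rintro ⟨M, rfl, h, ha⟩
      rcases M with _ | ⟨m, M⟩
      · simp only [List.nil_append] at h
        subst h
        simp only [List.append_nil] at ha ⊢
        simp [ha]
      · simp only [List.cons_append, List.cons.injEq] at h
        obtain ⟨rfl, rfl⟩ := h
        exact Or.inr ⟨M, by simp, rfl, ha⟩

lemma nodup_activeCuts (A B : List ℕ) : (activeCuts A B).Nodup := by
  induction B generalizing A with
  | nil => simp [activeCuts]
  | cons b B ih =>
    rw [activeCuts]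
    split_ifs with h
    · simp only [List.singleton_append, List.nodup_cons, ih, and_true]
      intro hm
      obtain ⟨M, h, -⟩ := mem_activeCuts.1 hm
      have := congrArg List.length h
      simp at this
    · simpa using ih _

lemma perm_range_succ_iff {n : ℕ} {l : List ℕ} :
    l.Perm (List.range (n + 1)) ↔
      ∃ A B, l = A ++ n :: B ∧ (A ++ B).Perm (List.range n) := by
  have h1 : (List.range (n + 1)).Perm (n :: List.range n) := by
    rw [List.range_succ]; exact List.perm_append_singleton _ _
  constructor
  · intro h
    obtain ⟨A, B, rfl⟩ := List.append_of_mem (h.symm.subset (by simp : n ∈ _))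
    exact ⟨A, B, rfl, (List.perm_cons n).1 ((List.perm_middle.symm.trans h).trans h1)⟩
  · rintro ⟨A, B, rfl, h⟩
    exact (List.perm_middle.trans (h.cons n)).trans h1.symm

lemma avoids_insert_iff {n : ℕ} {A B : List ℕ} (hA : ∀ a ∈ A, a < n) (hB : ∀ b ∈ B, b < n) :
    Avoids1342 (A ++ n :: B) ↔ Avoids1342 (A ++ B) ∧ IsActive A B := by
  constructor
  · intro h
    refine ⟨fun a b c d hs => h a b c d (hs.trans ?_), fun a c hac b hb hlt => ?_⟩
    · exact List.Sublist.append (List.Sublist.refl _) (List.sublist_cons_self _ _)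
    · refine h a c n b ?_ ⟨hlt.1, hlt.2, hA c (hac.subset (by simp))⟩
      exact List.Sublist.append (l₁ := [a, c]) hac ((List.singleton_sublist.2 hb).cons_cons n)
  · rintro ⟨h1, h2⟩ a b c d hs ⟨had, hdb, hbc⟩
    obtain ⟨l₁, l₂, he, hl₁, hl₂⟩ := List.sublist_append_iff.1 hs
    have hle : ∀ x ∈ A ++ n :: B, x ≤ n := by
      intro x hx
      simp only [List.mem_append, List.mem_cons] at hx
      rcases hx with hx | rfl | hx
      · exact (hA x hx).le
      · exact le_rfl
      · exact (hB x hx).le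
    have hcn : c ≤ n := hle c (hs.subset (by simp))
    rcases List.sublist_cons_iff.1 hl₂ with hl | ⟨r, rfl, hl⟩
    · exact h1 a b c d (he ▸ hl₁.append hl) ⟨had, hdb, hbc⟩
    · -- the new entry exceeds all others, so it can only play the largest entry of the pattern
      rcases l₁ with _ | ⟨x, _ | ⟨y, _ | ⟨z, _ | ⟨t, l₁⟩⟩⟩⟩ <;>
        simp only [List.nil_append, List.cons_append, List.cons.injEq] at he
      · omega
      · omega
      · obtain ⟨rfl, rfl, rfl, rfl⟩ := he
        exact h2 a b hl₁ d (hl.subset (by simp)) ⟨had, hdb⟩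
      · omega
      · obtain ⟨-, -, -, -, h⟩ := he
        simp at h

lemma mem_avoiders {n : ℕ} {l : List ℕ} :
    l ∈ avoiders n ↔ l.Perm (List.range n) ∧ Avoids1342 l := by
  induction n generalizing l with
  | zero =>
    simp only [avoiders, List.mem_singleton, List.range_zero, List.perm_nil]
    constructor
    · rintro rfl
      exact ⟨rfl, fun a b c d h => by simp at h⟩
    · exact And.left
  | succ n ih =>
    simp only [avoiders, List.mem_flatMap, List.mem_map, Prod.exists, mem_activeCuts,
      List.nil_append, perm_range_succ_iff]
    have hlt : ∀ {A B : List ℕ}, (A ++ B).Perm (List.range n) →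
        (∀ a ∈ A, a < n) ∧ ∀ b ∈ B, b < n := fun h =>
      ⟨fun a ha => List.mem_range.1 (h.subset (by simp [ha])),
        fun a ha => List.mem_range.1 (h.subset (by simp [ha]))⟩
    constructor
    · rintro ⟨l₀, hl₀, A, B, ⟨_, rfl, rfl, hact⟩, rfl⟩
      obtain ⟨hp, hav⟩ := ih.1 hl₀
      exact ⟨⟨A, B, rfl, hp⟩, (avoids_insert_iff (hlt hp).1 (hlt hp).2).2 ⟨hav, hact⟩⟩
    · rintro ⟨⟨A, B, rfl, hp⟩, hav⟩
      obtain ⟨hav', hact⟩ := (avoids_insert_iff (hlt hp).1 (hlt hp).2).1 hav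
      exact ⟨A ++ B, ih.2 ⟨hp, hav'⟩, A, B, ⟨A, rfl, rfl, hact⟩, rfl⟩

lemma lt_of_mem_avoiders {n : ℕ} {l : List ℕ} (hl : l ∈ avoiders n) : ∀ a ∈ l, a < n :=
  fun _ ha => List.mem_range.1 ((mem_avoiders.1 hl).1.subset ha)

lemma append_cons_inj_of_lt {n : ℕ} {A B A' B' : List ℕ} (h : A ++ n :: B = A' ++ n :: B')
    (hA : ∀ a ∈ A, a < n) (hA' : ∀ a ∈ A', a < n) : A = A' ∧ B = B' := by
  induction A generalizing A' with
  | nil =>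
    rcases A' with _ | ⟨a, A'⟩
    · simpa using h
    · simp only [List.nil_append, List.cons_append, List.cons.injEq] at h
      have := hA' a (by simp)
      omega
  | cons a A ih =>
    rcases A' with _ | ⟨a', A'⟩
    · simp only [List.nil_append, List.cons_append, List.cons.injEq] at h
      have := hA a (by simp)
      omega
    · simp only [List.cons_append, List.cons.injEq] at h
      obtain ⟨rfl, rfl⟩ := ih h.2 (fun x hx => hA x (by simp [hx]))
        (fun x hx => hA' x (by simp [hx]))
      simp [h.1]

lemma nodup_avoiders (n : ℕ) : (avoiders n).Nodup := by
  induction n with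
  | zero => simp [avoiders]
  | succ n ih =>
    have key : ∀ l ∈ avoiders n, ∀ c ∈ activeCuts [] l, l = c.1 ++ c.2 ∧ ∀ a ∈ c.1, a < n := by
      rintro l hl ⟨A, B⟩ hc
      obtain ⟨M, rfl, rfl, -⟩ := mem_activeCuts.1 hc
      exact ⟨by simp, fun a ha => lt_of_mem_avoiders hl a (by simp at ha; simp [ha])⟩
    rw [avoiders, List.nodup_flatMap]
    constructor
    · intro l hl
      refine (nodup_activeCuts [] l).map_on ?_
      rintro c hc c' hc' h
      obtain ⟨h1, h2⟩ := append_cons_inj_of_lt h (key l hl c hc).2 (key l hl c' hc').2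
      exact Prod.ext h1 h2
    · refine ih.pairwise_of_forall_ne ?_
      intro l hl l' hl' hne
      simp only [Function.onFun, List.disjoint_left, List.mem_map, not_exists, not_and]
      rintro x ⟨c, hc, rfl⟩ c' hc' h
      obtain ⟨h1, h2⟩ := append_cons_inj_of_lt h (key l' hl' c' hc').2 (key l hl c hc).2
      exact hne ((key l hl c hc).1.trans (by rw [(key l' hl' c' hc').1, h1, h2]))

lemma map_marks_avoiders (n : ℕ) : (avoiders n).map (marks []) = walks n := by
  induction n with
  | zero => simp [avoiders, walks, marks, isSkew_nil_right]
  | succ n ih =>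
    rw [avoiders, walks, ← ih, List.map_flatMap, List.flatMap_map]
    refine List.flatMap_congr ?_
    intro l hl
    rw [List.map_map]
    exact map_marks_insert (by simp) (lt_of_mem_avoiders hl)

lemma avoids_ofFn_iff {n : ℕ} (p : Equiv.Perm (Fin n)) :
    Avoids1342 (List.ofFn fun i => (p i : ℕ)) ↔ AvoidsPattern p pattern1342 := by
  rw [AvoidsPattern, ContainsPattern]
  constructor
  · rintro h ⟨f, hf, hp⟩
    refine h (p (f 0)) (p (f 1)) (p (f 2)) (p (f 3)) ?_ ?_
    · rw [List.sublist_iff_exists_fin_orderEmbedding_get_eq]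
      refine ⟨(OrderEmbedding.ofStrictMono f hf).trans
        (Fin.castOrderIso (by simp)).toOrderEmbedding, ?_⟩
      intro i
      change Fin 4 at i
      fin_cases i <;> simp
    · have h03 := (hp 0 3).2 (by decide)
      have h31 := (hp 3 1).2 (by decide)
      have h12 := (hp 1 2).2 (by decide)
      exact ⟨h03, h31, h12⟩
  · intro h a b c d hs ⟨had, hdb, hbc⟩
    rw [List.sublist_iff_exists_fin_orderEmbedding_get_eq] at hs
    obtain ⟨f, hf⟩ := hs
    refine h ⟨fun i : Fin 4 => Fin.cast (by simp) (f i), fun i j hij => ?_, ?_⟩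
    · simpa using f.strictMono hij
    · have key : ∀ i : Fin 4, ((p (Fin.cast (by simp) (f i)) : Fin n) : ℕ) = ![a, b, c, d] i := by
        intro i
        have := hf i
        simp only [List.get_eq_getElem, List.getElem_ofFn] at this
        fin_cases i <;> exact this.symm
      intro i j
      rw [Fin.lt_def, key, key]
      fin_cases i <;> fin_cases j <;> simp [pattern1342] <;> omega

/-- The permutations that avoid `1342` are counted by walks. -/
theorem numAvoiding_eq_length_walks (n : ℕ) :
    numAvoiding n pattern1342 = (walks n).length := by
  rw [← map_marks_avoiders, List.length_map, ← List.toFinset_card_of_nodup (nodup_avoiders n),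
    ← Fintype.card_coe, ← Nat.card_eq_fintype_card]
  refine Nat.card_eq_of_bijective
    (fun p : {p : Equiv.Perm (Fin n) // AvoidsPattern p pattern1342} =>
      (⟨List.ofFn fun i => (p.1 i : ℕ), ?_⟩ : (avoiders n).toFinset)) ⟨?_, ?_⟩
  · rw [List.mem_toFinset, mem_avoiders, avoids_ofFn_iff]
    refine ⟨?_, p.2⟩
    rw [List.perm_ext_iff_of_nodup ?_ List.nodup_range]
    · intro a
      simp only [List.mem_ofFn, List.mem_range]
      constructor
      · rintro ⟨i, rfl⟩; exact (p.1 i).2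
      · intro ha; exact ⟨p.1.symm ⟨a, ha⟩, by simp⟩
    · exact List.nodup_ofFn.2 fun i j h => p.1.injective (Fin.ext h)
  · intro p q h
    have h' := List.ofFn_injective (Subtype.ext_iff.1 h)
    exact Subtype.ext (Equiv.ext fun i => Fin.ext (congrFun h' i))
  · rintro ⟨l, hl⟩
    obtain ⟨hp, hav⟩ := mem_avoiders.1 (List.mem_toFinset.1 hl)
    have hlen : l.length = n := by simpa using hp.length_eq
    have hnd : l.Nodup := hp.nodup_iff.2 List.nodup_range
    have hlt : ∀ a ∈ l, a < n := fun a ha => List.mem_range.1 (hp.subset ha)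
    subst hlen
    let f : Fin l.length → Fin l.length := fun i => ⟨l.get i, hlt _ (List.get_mem l i)⟩
    have hf : Function.Injective f := fun i j h =>
      hnd.injective_get (congrArg Fin.val h)
    let p : Equiv.Perm (Fin l.length) := Equiv.ofBijective f (Finite.injective_iff_bijective.1 hf)
    have hpl : (List.ofFn fun i => (p i : ℕ)) = l := List.ofFn_get l
    refine ⟨⟨p, (avoids_ofFn_iff p).1 (by rwa [hpl])⟩, Subtype.ext hpl⟩

/-! ### Decomposition of walks and the functional equation -/

section Decomposition

variable {R : Type*} [CommRing R]

/-- The sum of `f` over the end points of the `n`-step walks. -/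
def walkSum (n : ℕ) (f : List Bool → R) : R := ((walks n).map f).sum

/-- The sum of `ψ A T` over all ways to write a word of marks as `A ++ T` where `T` begins with
`true`. -/
def splitSum : (List Bool → List Bool → R) → List Bool → R
  | _, [] => 0
  | ψ, s :: L => (if s then ψ [] (s :: L) else 0) + splitSum (fun A T => ψ (s :: A) T) L

lemma walkSum_zero (f : List Bool → R) : walkSum 0 f = f [true] := by
  simp [walkSum, walks]

lemma walkSum_succ (n : ℕ) (f : List Bool → R) :
    walkSum (n + 1) f = walkSum n fun L => ((successorsFrom 0 L).map f).sum := by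
  simp only [walkSum, walks]
  induction walks n with
  | nil => simp
  | cons L l ih => simp [ih]

lemma walkSum_add (n : ℕ) (f χ : List Bool → R) :
    walkSum n (fun L => f L + χ L) = walkSum n f + walkSum n χ := by
  simp [walkSum, List.sum_map_add]

lemma walkSum_mul_left (n : ℕ) (r : R) (f : List Bool → R) :
    walkSum n (fun L => r * f L) = r * walkSum n f := by
  simp [walkSum, List.sum_map_mul_left]

lemma walkSum_mul_right (n : ℕ) (r : R) (f : List Bool → R) :
    walkSum n (fun L => f L * r) = walkSum n f * r := by
  simp [walkSum, List.sum_map_mul_right]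

lemma walkSum_one (n : ℕ) : walkSum n (fun _ => (1 : R)) = (walks n).length := by
  simp [walkSum]

lemma walkSum_congr {n : ℕ} {f χ : List Bool → R} (h : ∀ L ∈ walks n, f L = χ L) :
    walkSum n f = walkSum n χ := by
  rw [walkSum, walkSum, List.map_congr_left h]

lemma splitSum_zero (L : List Bool) : splitSum (fun _ _ => (0 : R)) L = 0 := by
  induction L with
  | nil => rfl
  | cons s L ih => simp [splitSum, ih]

lemma splitSum_add (ψ χ : List Bool → List Bool → R) (L : List Bool) :
    splitSum (fun A T => ψ A T + χ A T) L = splitSum ψ L + splitSum χ L := by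
  induction L generalizing ψ χ with
  | nil => simp [splitSum]
  | cons s L ih =>
    rw [splitSum, splitSum, splitSum, ih]
    split_ifs <;> ring

lemma splitSum_replicate_append (c : ℕ) (ψ : List Bool → List Bool → R) (L : List Bool) :
    splitSum ψ (List.replicate c false ++ L) =
      splitSum (fun A T => ψ (List.replicate c false ++ A) T) L := by
  induction c generalizing ψ with
  | zero => simp
  | succ c ih => simp [List.replicate_succ, splitSum, ih]

lemma splitSum_dropWhile (ψ : List Bool → List Bool → R) (L : List Bool) :
    splitSum ψ (L.dropWhile fun b => !b) =
      splitSum (fun A T => ψ (A.dropWhile fun b => !b) T) L := by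
  induction L generalizing ψ with
  | nil => simp [splitSum]
  | cons s L ih =>
    cases s
    · simp [splitSum, ih]
    · simp [splitSum]

lemma exists_dropWhile_append_true (A : List Bool) :
    ∃ D, ((A ++ [true]).dropWhile fun b => !b) = (A.dropWhile fun b => !b) ++ [true] ∧
      (A.dropWhile fun b => !b) ++ [true] = true :: D := by
  induction A with
  | nil => exact ⟨[], by simp⟩
  | cons s A ih =>
    cases s
    · simpa using ih
    · exact ⟨A ++ [true], by simp⟩

/-- A step of a walk from `A ++ T` that keeps `T` acts on `A` as a step from `A ++ [true]` acts,
because `T` begins with `true`. -/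
lemma sum_splitSum_successorsFrom (c : ℕ) (ψ : List Bool → List Bool → R) (L : List Bool) :
    ((successorsFrom c L).map (splitSum ψ)).sum =
      ((successorsFrom c L).map (ψ [])).sum +
        splitSum (fun A T =>
          ((successorsFrom c (A ++ [true])).map fun L' => ψ L'.dropLast T).sum) L := by
  induction L generalizing c with
  | nil => simp [successorsFrom, splitSum]
  | cons s L ih =>
    have h1 : splitSum ψ (true :: List.replicate c false ++ (s :: L).dropWhile fun b => !b) =
        ψ [] (true :: List.replicate c false ++ (s :: L).dropWhile fun b => !b) +
          splitSum (fun A T => ψ (true :: List.replicate c false ++ A.dropWhile fun b => !b) T)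
            (s :: L) := by
      rw [List.cons_append, splitSum, splitSum_replicate_append, splitSum_dropWhile]
      simp
    have h2 : ∀ A T, ((successorsFrom c (s :: A ++ [true])).map fun L' => ψ L'.dropLast T).sum =
        ψ (true :: List.replicate c false ++ (s :: A).dropWhile fun b => !b) T +
          ((successorsFrom (c + 1) (A ++ [true])).map fun L' => ψ L'.dropLast T).sum := by
      intro A T
      obtain ⟨D, hD, -⟩ := exists_dropWhile_append_true (s :: A)
      rw [List.cons_append] at hD
      rw [List.cons_append, successorsFrom, List.map_cons, List.sum_cons, hD, ← List.append_assoc,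
        List.dropLast_concat]
    have h3 : splitSum (fun A T =>
          ((successorsFrom c (A ++ [true])).map fun L' => ψ L'.dropLast T).sum) (s :: L) =
        splitSum (fun A T => ψ (true :: List.replicate c false ++ A.dropWhile fun b => !b) T)
            (s :: L) +
          splitSum (fun A T =>
            ((successorsFrom (c + 1) (A ++ [true])).map fun L' => ψ L'.dropLast T).sum) L := by
      rw [splitSum, splitSum]
      simp only [h2]
      rw [splitSum_add, ← add_assoc]
      have h4 : (true :: (List.replicate c false ++ [true])).dropLast =
          true :: List.replicate c false := by
        rw [← List.cons_append, List.dropLast_concat]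
      cases s <;> simp [successorsFrom, h4]
    rw [successorsFrom, List.map_cons, List.sum_cons, List.map_cons, List.sum_cons, ih, h1, h3]
    ring

lemma dropLast_append_of_mem_walks {n : ℕ} {L : List Bool} (h : L ∈ walks n) :
    L.dropLast ++ [true] = L := by
  have key : ∀ (A : List Bool) (c : ℕ), ∀ L ∈ successorsFrom c (A ++ [true]),
      L.dropLast ++ [true] = L := by
    intro A
    induction A with
    | nil =>
      intro c L hL
      simp only [List.nil_append, successorsFrom, List.mem_singleton] at hL
      subst hL
      have : [true].dropWhile (fun b => !b) = [true] := rfl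
      rw [this, List.dropLast_concat]
    | cons s A ih =>
      intro c L hL
      rw [List.cons_append, successorsFrom, List.mem_cons] at hL
      rcases hL with rfl | hL
      · obtain ⟨D, hD, -⟩ := exists_dropWhile_append_true (s :: A)
        rw [List.cons_append] at hD
        rw [hD, ← List.append_assoc, List.dropLast_concat]
      · exact ih _ _ hL
  induction n generalizing L with
  | zero => simp only [walks, List.mem_singleton] at h; subst h; rfl
  | succ n ih =>
    rw [walks, List.mem_flatMap] at h
    obtain ⟨L₀, h0, hL⟩ := h
    rw [← ih h0] at hL
    exact key _ _ _ hL

/-- Cutting a walk that ends at `A ++ T` at its last visit to `T`: the rest of the walk stays above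
`T`, and replacing `T` by `[true]` turns it into a walk from the starting point to
`A ++ [true]`. -/
theorem walkSum_splitSum (n : ℕ) (ψ : List Bool → List Bool → R) :
    walkSum n (splitSum ψ) = ∑ p ∈ Finset.HasAntidiagonal.antidiagonal n,
      walkSum p.1 fun T => walkSum p.2 fun L => ψ L.dropLast T := by
  induction n generalizing ψ with
  | zero => simp [walkSum_zero, splitSum]
  | succ n ih =>
    rw [walkSum_succ]
    simp only [sum_splitSum_successorsFrom]
    rw [walkSum_add, ← walkSum_succ, ih, Finset.Nat.sum_antidiagonal_succ']
    congr 1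
    · simp [walkSum_zero]
    · refine Finset.sum_congr rfl fun p _ => walkSum_congr fun T _ => ?_
      rw [walkSum_succ]
      exact walkSum_congr fun L hL => by rw [dropLast_append_of_mem_walks hL]

/-- The weight `u ^ |A| * g T` of a split `A ++ T` whose left part is a single block
`true, false, …, false`; all other splits have weight `0`. -/
def blockWeight (u : R) (g : List Bool → R) (A T : List Bool) : R :=
  if A = true :: List.replicate (A.length - 1) false then u ^ A.length * g T else 0

lemma splitSum_blockWeight (u : R) (g : List Bool → R) (c : ℕ) (D : List Bool) :
    splitSum (blockWeight u g) (true :: List.replicate c false ++ true :: D) =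
      u ^ (c + 1) * g (true :: D) := by
  rw [List.cons_append, splitSum, splitSum_replicate_append, splitSum]
  have h0 : (fun A T => blockWeight u g (true :: (List.replicate c false ++ true :: A)) T) =
      fun _ _ => 0 := by
    funext A T
    rw [blockWeight, if_neg]
    intro h
    have : true ∈ List.replicate (c + (A.length + 1)) false := by
      have h' := (List.cons.inj h).2
      simp only [List.length_cons, List.length_append, List.length_replicate,
        Nat.add_sub_cancel] at h'
      rw [← h']; simp
    simp at this
  rw [h0, splitSum_zero]
  simp [blockWeight]

/-- The contribution of the walks that end at a word `A ++ [true]` where `A` is a single block. -/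
def blockSum (u : R) (n : ℕ) : R := walkSum n fun L => blockWeight u (fun _ => 1) L.dropLast []

lemma blockSum_zero (u : R) : blockSum u 0 = 0 := by
  simp [blockSum, walkSum_zero, blockWeight]

lemma walkSum_splitSum_blockWeight (u : R) (g : List Bool → R) (n : ℕ) :
    walkSum n (splitSum (blockWeight u g)) =
      ∑ p ∈ Finset.HasAntidiagonal.antidiagonal n, walkSum p.1 g * blockSum u p.2 := by
  rw [walkSum_splitSum]
  refine Finset.sum_congr rfl fun p _ => ?_
  rw [← walkSum_mul_right]
  refine walkSum_congr fun T _ => ?_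
  rw [blockSum, ← walkSum_mul_left]
  refine walkSum_congr fun L _ => ?_
  simp only [blockWeight]
  split_ifs <;> ring

lemma sum_successorsFrom_length (u : R) (c : ℕ) (A : List Bool) :
    ((successorsFrom c (A ++ [true])).map (splitSum (blockWeight u fun T => u ^ T.length))).sum =
      ((successorsFrom c (A ++ [true])).map fun L => u ^ L.length).sum := by
  induction A generalizing c with
  | nil =>
    have := splitSum_blockWeight u (fun T => u ^ T.length) c []
    simp only [List.nil_append, successorsFrom, List.map_cons, List.map_nil, List.sum_cons,
      List.sum_nil, add_zero, List.dropWhile, Bool.not_true]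
    rw [this]
    simp [pow_succ]
  | cons s A ih =>
    obtain ⟨D, hD, hD'⟩ := exists_dropWhile_append_true (s :: A)
    rw [List.cons_append, hD'] at hD
    rw [List.cons_append, successorsFrom, List.map_cons, List.sum_cons, List.map_cons,
      List.sum_cons, ih, hD, splitSum_blockWeight]
    simp only [List.length_append, List.length_cons, List.length_replicate]
    ring

lemma sum_successorsFrom_one (u : R) (c : ℕ) (A : List Bool) :
    ((successorsFrom c (A ++ [true])).map (splitSum (blockWeight u fun _ => 1))).sum * (u - 1) =
      u ^ (c + 1) * (u ^ (A.length + 1) - 1) := by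
  induction A generalizing c with
  | nil =>
    have := splitSum_blockWeight u (fun _ => 1) c []
    simp only [List.nil_append, successorsFrom, List.map_cons, List.map_nil, List.sum_cons,
      List.sum_nil, add_zero, List.dropWhile, Bool.not_true]
    rw [this]
    simp
  | cons s A ih =>
    obtain ⟨D, hD, hD'⟩ := exists_dropWhile_append_true (s :: A)
    rw [List.cons_append, hD'] at hD
    rw [List.cons_append, successorsFrom, List.map_cons, List.sum_cons, add_mul, ih, hD,
      splitSum_blockWeight, List.length_cons]
    ring

/-- The walks of `n + 1` steps, weighted by the length of the end point and decomposed at the first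
block of the end point. -/
lemma walkSum_pow_length_succ (u : R) (n : ℕ) :
    walkSum (n + 1) (fun L => u ^ L.length) =
      ∑ p ∈ Finset.HasAntidiagonal.antidiagonal (n + 1),
        walkSum p.1 (fun L => u ^ L.length) * blockSum u p.2 := by
  rw [← walkSum_splitSum_blockWeight, walkSum_succ, walkSum_succ]
  refine walkSum_congr fun L hL => ?_
  rw [← dropLast_append_of_mem_walks hL, sum_successorsFrom_length]

/-- The walks of `n + 1` steps, weighted by the length `i` of the first block of the end point. On
the left, `i` takes each value from `1` to the length of the previous point once, which gives a
geometric sum; on the right, the walks are decomposed at that block. -/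
lemma walkSum_sub_one (u : R) (n : ℕ) :
    u * (walkSum n (fun L => u ^ L.length) - (walks n).length) =
      (∑ p ∈ Finset.HasAntidiagonal.antidiagonal (n + 1), ((walks p.1).length : R) * blockSum u p.2) *
        (u - 1) := by
  simp only [← walkSum_one]
  rw [← walkSum_splitSum_blockWeight, walkSum_succ, ← walkSum_mul_right, sub_eq_add_neg,
    ← neg_one_mul, ← walkSum_mul_left, ← walkSum_add, ← walkSum_mul_left]
  refine walkSum_congr fun L hL => ?_
  have h := sum_successorsFrom_one u 0 L.dropLast
  have hl : L.dropLast.length + 1 = L.length := by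
    conv_rhs => rw [← dropLast_append_of_mem_walks hL]
    simp
  rw [dropLast_append_of_mem_walks hL, hl] at h
  rw [h]
  ring

end Decomposition

open PowerSeries in
/-- The generating function of `1342`-avoiding permutations by length. -/
noncomputable def avoiderSeries : ℚ⟦X⟧ := mk fun n => ((walks n).length : ℚ)

open PowerSeries in
/-- The generating function of `1342`-avoiding permutations by length and, marked by the polynomial
variable, by the number of active cuts. -/
noncomputable def cutSeries : (Polynomial ℚ)⟦X⟧ :=
  mk fun n => walkSum n fun L => (Polynomial.X : Polynomial ℚ) ^ L.length

open PowerSeries in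
lemma map_eval_cutSeries :
    map (Polynomial.evalRingHom 1) cutSeries = avoiderSeries := by
  ext n
  simp only [cutSeries, avoiderSeries, coeff_map, coeff_mk, walkSum, map_list_sum, List.map_map]
  rw [show (⇑(Polynomial.evalRingHom (1 : ℚ)) ∘ fun L : List Bool =>
    (Polynomial.X : Polynomial ℚ) ^ L.length) = fun _ => 1 by funext L; simp]
  simp

open PowerSeries in
theorem cutSeries_functional_equation :
    map Polynomial.C avoiderSeries * (cutSeries - C Polynomial.X) * (C Polynomial.X - 1) =
      X * C Polynomial.X * cutSeries * (cutSeries - map Polynomial.C avoiderSeries) := by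
  set B : (Polynomial ℚ)⟦X⟧ := mk (blockSum Polynomial.X) with hB
  have h1 : cutSeries - C Polynomial.X = cutSeries * B := by
    ext1 n
    rcases n with _ | n
    · simp [cutSeries, hB, blockSum_zero, walkSum_zero]
    · rw [coeff_mul]
      simp [cutSeries, hB, walkSum_pow_length_succ]
  have h2 : map Polynomial.C avoiderSeries * B * (C Polynomial.X - 1) =
      X * (C Polynomial.X * (cutSeries - map Polynomial.C avoiderSeries)) := by
    ext1 n
    rw [show (C Polynomial.X - 1 : (Polynomial ℚ)⟦X⟧) = C (Polynomial.X - 1) by simp,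
      coeff_mul_C]
    rcases n with _ | n
    · simp [avoiderSeries, hB, blockSum_zero]
    · rw [coeff_succ_X_mul, coeff_C_mul, coeff_mul]
      have := walkSum_sub_one (Polynomial.X : Polynomial ℚ) n
      simpa [avoiderSeries, cutSeries, hB] using this.symm
  linear_combination (map Polynomial.C avoiderSeries) * (C Polynomial.X - 1) * h1 + cutSeries * h2

/-! ### Solution of the functional equation -/

section Solution

open PowerSeries

lemma exists_eq_one_add_mul_sq {A : Type*} [CommRing A] (t : A⟦X⟧)
    (ht : constantCoeff t = 0) : ∃ c : A⟦X⟧, c = 1 + t * c ^ 2 := by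
  have hs : HasSubst t := HasSubst.of_constantCoeff_zero' ht
  refine ⟨substAlgHom hs (map (Nat.castRingHom A) catalanSeries), ?_⟩
  have h := congrArg (fun f => substAlgHom hs (map (Nat.castRingHom A) f))
    catalanSeries_sq_mul_X_add_one
  simp only [map_add, map_mul, map_pow, map_one, map_X, substAlgHom_X] at h
  linear_combination -h

lemma constantCoeff_eq_one_of_eq {A : Type*} [CommRing A] {t c : A⟦X⟧}
    (ht : constantCoeff t = 0) (hc : c = 1 + t * c ^ 2) : constantCoeff c = 1 := by
  rw [hc]; simp [ht]

lemma eq_of_eq_one_add_mul_sq {A : Type*} [CommRing A] [IsDomain A] {t c d : A⟦X⟧}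
    (ht : constantCoeff t = 0) (hc : c = 1 + t * c ^ 2) (hd : d = 1 + t * d ^ 2) : c = d := by
  have h : (c - d) * (1 - t * (c + d)) = 0 := by linear_combination hc - hd
  rcases mul_eq_zero.1 h with h | h
  · exact sub_eq_zero.1 h
  · have := congrArg constantCoeff h
    simp [ht] at this

lemma constantCoeff_map_eq {A B : Type*} [CommRing A] [CommRing B] (g : A →+* B) (f : A⟦X⟧) :
    constantCoeff (map g f) = g (constantCoeff f) := by
  simp only [← coeff_zero_eq_constantCoeff_apply, coeff_map]

/-- The functional equation, in which the polynomial variable is specialised to `1` in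
`map (evalRingHom 1) F`, has at most one solution with given constant coefficient. -/
theorem eq_of_functional_equation {F G : (Polynomial ℚ)⟦X⟧}
    (hF0 : constantCoeff F = Polynomial.X) (hG0 : constantCoeff G = Polynomial.X)
    (hF : map Polynomial.C (map (Polynomial.evalRingHom 1) F) * (F - C Polynomial.X) *
      (C Polynomial.X - 1) =
      X * C Polynomial.X * F * (F - map Polynomial.C (map (Polynomial.evalRingHom 1) F)))
    (hG : map Polynomial.C (map (Polynomial.evalRingHom 1) G) * (G - C Polynomial.X) *
      (C Polynomial.X - 1) =
      X * C Polynomial.X * G * (G - map Polynomial.C (map (Polynomial.evalRingHom 1) G))) :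
    F = G := by
  set E : (Polynomial ℚ)⟦X⟧ →+* (Polynomial ℚ)⟦X⟧ :=
    (map Polynomial.C).comp (map (Polynomial.evalRingHom 1)) with hE
  have hEX : E X = X := by simp [hE]
  have hF' : E F * (F - C Polynomial.X) * (C Polynomial.X - 1) =
    X * C Polynomial.X * F * (F - E F) := hF
  have hG' : E G * (G - C Polynomial.X) * (C Polynomial.X - 1) =
    X * C Polynomial.X * G * (G - E G) := hG
  have hEF : constantCoeff (E F) = 1 := by
    simp [hE, constantCoeff_map_eq, hF0]
  obtain ⟨g, hg⟩ : X ∣ G - C Polynomial.X := by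
    rw [X_dvd_iff]; simp [hG0]
  -- each power of `X` that divides the difference can be raised by one
  have key : ∀ n : ℕ, X ^ n ∣ F - G := by
    intro n
    induction n with
    | zero => simp
    | succ n ih =>
      obtain ⟨e, he⟩ := ih
      have hEe : E F - E G = X ^ n * E e := by
        rw [← map_sub, he, map_mul, map_pow, hEX]
      have h1 : X ^ n * (E F * e * (C Polynomial.X - 1)) = X ^ n * (X * (C Polynomial.X *
          (e * (F + G) - e * E F - G * E e) - E e * g * (C Polynomial.X - 1))) := by
        linear_combination hF' - hG' - E F * (C Polynomial.X - 1) * he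
          - (G - C Polynomial.X) * (C Polynomial.X - 1) * hEe
          - X ^ n * E e * (C Polynomial.X - 1) * hg
          + X * C Polynomial.X * (F + G - E F) * he - X * C Polynomial.X * G * hEe
      have h2 := mul_left_cancel₀ (pow_ne_zero n X_ne_zero) h1
      have h3 := congrArg constantCoeff h2
      simp only [map_mul, map_sub, hEF, constantCoeff_X, constantCoeff_C, map_one, one_mul,
        zero_mul] at h3
      have h4 : (Polynomial.X - 1 : Polynomial ℚ) ≠ 0 := Polynomial.X_sub_C_ne_zero 1
      have h5 : X ∣ e := X_dvd_iff.2 ((mul_eq_zero.1 h3).resolve_right h4)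
      rw [he, pow_succ]
      exact mul_dvd_mul_left _ h5
  rw [← sub_eq_zero]
  ext1 n
  exact X_pow_dvd_iff.1 (key (n + 1)) n (Nat.lt_succ_self n)

/-- The parametrisation of the generating function by a quadratic series `U`. -/
theorem exists_avoiderSeries_eq :
    ∃ U : ℚ⟦X⟧, constantCoeff U = 1 ∧ (1 + X) * U ^ 2 - 3 * U + 2 = 0 ∧
      avoiderSeries = U ^ 2 * (2 - U) := by
  obtain ⟨Y, hY⟩ := exists_eq_one_add_mul_sq (2 * X : ℚ⟦X⟧) (by simp)
  have h1X : (1 + X : ℚ⟦X⟧) * (1 + X)⁻¹ = 1 := PowerSeries.mul_inv_cancel _ (by simp)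
  set U : ℚ⟦X⟧ := (1 + 2 * X * Y) * (1 + X)⁻¹ with hU
  have hU0 : constantCoeff U = 1 := by simp [hU]
  have hXU : (1 + X) * U = 1 + 2 * X * Y := by
    rw [hU]; linear_combination (1 + 2 * X * Y) * h1X
  have hq : (1 + X) * U ^ 2 - 3 * U + 2 = 0 := by
    have h : (1 + X) * ((1 + X) * U ^ 2 - 3 * U + 2) = 0 := by
      linear_combination ((1 + X) * U + (1 + 2 * X * Y) - 3) * hXU - 2 * X * hY
    refine (mul_eq_zero.1 h).resolve_left fun h0 => ?_
    simpa using congrArg constantCoeff h0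
  clear_value U
  refine ⟨U, hU0, hq, ?_⟩
  have hUi : U * U⁻¹ = 1 := PowerSeries.mul_inv_cancel _ (by simp [hU0])
  set ι : ℚ⟦X⟧ →+* (Polynomial ℚ)⟦X⟧ := map Polynomial.C with hι
  set ε : (Polynomial ℚ)⟦X⟧ →+* ℚ⟦X⟧ := map (Polynomial.evalRingHom 1) with hε
  have hει : ∀ f, ε (ι f) = f := by
    intro f; ext n; simp [hι, hε]
  set u : (Polynomial ℚ)⟦X⟧ := C Polynomial.X with hu
  have hεu : ε u = 1 := by simp [hε, hu]
  set t : (Polynomial ℚ)⟦X⟧ := u * ι ((U - 1) * U⁻¹ ^ 2) with ht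
  have ht0 : constantCoeff t = 0 := by
    have : constantCoeff (ι ((U - 1) * U⁻¹ ^ 2)) = 0 := by
      simp [hι, constantCoeff_map_eq, hU0]
    rw [ht, map_mul, this, mul_zero]
  obtain ⟨c, hc⟩ := exists_eq_one_add_mul_sq t ht0
  -- at `u = 1` the auxiliary series becomes `U` itself
  have hεc : ε c = U := by
    have ht1 : ε t = (U - 1) * U⁻¹ ^ 2 := by rw [ht, map_mul, hεu, hει, one_mul]
    refine eq_of_eq_one_add_mul_sq (t := ε t) ?_ ?_ ?_
    · rw [ht1]; simp [hU0]
    · conv_lhs => rw [hc]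
      simp
    · rw [ht1]
      linear_combination (-(U - 1) * (U * U⁻¹ + 1)) * hUi
  have hιUi : ι U * ι U⁻¹ = 1 := by rw [← map_mul, hUi, map_one]
  have hc' : ι U ^ 2 * (c - 1) = u * (ι U - 1) * c ^ 2 := by
    have : t = u * ((ι U - 1) * ι U⁻¹ ^ 2) := by rw [ht]; simp
    rw [this] at hc
    linear_combination ι U ^ 2 * hc + (u * (ι U - 1) * c ^ 2) * (ι U * ι U⁻¹ + 1) * hιUi
  have hx : X * ι U ^ 2 = (ι U - 1) * (2 - ι U) := by
    have h := congrArg ι hq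
    simp only [map_add, map_sub, map_mul, map_pow, map_one, map_zero, map_ofNat] at h
    rw [show ι X = X by simp [hι]] at h
    linear_combination h
  set G : (Polynomial ℚ)⟦X⟧ := ι U * (ι U - (ι U - u) * c) with hG
  have hεG : ε G = U ^ 2 * (2 - U) := by
    rw [hG, map_mul, map_sub, map_mul, map_sub, hει, hεu, hεc]; ring
  have hc0 := constantCoeff_eq_one_of_eq ht0 hc
  have hιU0 : constantCoeff (ι U) = 1 := by simp [hι, constantCoeff_map_eq, hU0]
  have hG0 : constantCoeff G = Polynomial.X := by
    simp [hG, hιU0, hc0, hu]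
  have hGeq : ι (ε G) * (G - u) * (u - 1) = X * u * G * (G - ι (ε G)) := by
    have hι2 : ι (U ^ 2 * (2 - U)) = ι U ^ 2 * (2 - ι U) := by
      simp only [map_mul, map_pow, map_sub, map_ofNat]
    have hne : ι U ^ 2 ≠ 0 := by
      refine pow_ne_zero _ fun h => ?_
      rw [h] at hιU0; simp at hιU0
    rw [hεG, hι2]
    refine mul_left_cancel₀ hne ?_
    rw [hG]
    linear_combination (2 - ι U) * ι U ^ 2 * (ι U - u) ^ 2 * hc' -
      u * (ι U * (ι U - (ι U - u) * c)) *
        (ι U * (ι U - (ι U - u) * c) - ι U ^ 2 * (2 - ι U)) * hx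
  have hF0 : constantCoeff cutSeries = Polynomial.X := by
    rw [← coeff_zero_eq_constantCoeff_apply]
    simp [cutSeries, walkSum_zero]
  have hFG : cutSeries = G := by
    refine eq_of_functional_equation hF0 hG0 ?_ hGeq
    rw [map_eval_cutSeries]
    exact cutSeries_functional_equation
  rw [← hεG, ← hFG, hε, map_eval_cutSeries]

/-! ### Extraction of coefficients -/

/-- The algebraic equation of the generating function; the series `R` is `(1 - 8x)^(3/2)`. -/
theorem exists_sqrt_cube :
    ∃ R : ℚ⟦X⟧, 2 * (1 + X) ^ 3 * avoiderSeries = 1 + 20 * X - 8 * X ^ 2 + R ∧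
      coeff 0 R = 1 ∧ coeff 1 R = -12 ∧
      ∀ j : ℕ, coeff (j + 2) R = 3 * 2 ^ (j + 4) * ((2 * j)! : ℕ) / (((j + 2)! : ℕ) * (j ! : ℕ)) := by
  obtain ⟨U, hU0, hq, hS⟩ := exists_avoiderSeries_eq
  set D : ℚ⟦X⟧ := 3 - 2 * (1 + X) * U with hD
  have hD2 : D ^ 2 = 1 - 8 * X := by
    rw [hD]; linear_combination 4 * (1 + X) * hq
  have hD0 : constantCoeff D = 1 := by
    simp only [hD, map_sub, map_mul, map_add, map_one, map_ofNat, constantCoeff_X, hU0]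
    norm_num
  have hDS : 2 * (1 + X) ^ 3 * avoiderSeries = 1 + 20 * X - 8 * X ^ 2 + D ^ 3 := by
    rw [hS, hD]
    linear_combination (6 * (1 + X) ^ 2 * U + 4 * (1 + X) ^ 2 - 18 * (1 + X)) * hq
  clear_value D
  have h0 : coeff 0 (D ^ 3) = 1 := by
    simp [hD0]
  have h8 : (8 : ℚ⟦X⟧) = C 8 := (map_ofNat C 8).symm
  -- `D ^ 2 = 1 - 8x` gives the differential equation `(1 - 8x) (D ^ 3)' = -12 D ^ 3`
  have hdiff : (1 - 8 * X) * d⁄dX ℚ (D ^ 3) = -12 * D ^ 3 := by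
    have h := congrArg (d⁄dX ℚ) hD2
    rw [h8] at h
    rw [derivative_pow, map_sub, Derivation.leibniz, derivative_C, derivative_X,
      derivative_one, smul_eq_mul, smul_eq_mul, ← h8] at h
    rw [derivative_pow, ← hD2]
    norm_num at h ⊢
    have h2 : (2 : ℚ⟦X⟧) ≠ 0 := fun h0 => by
      have := congrArg constantCoeff h0
      rw [map_ofNat, map_zero] at this
      norm_num at this
    refine mul_left_cancel₀ h2 ?_
    linear_combination 3 * D ^ 3 * h
  have hrec : ∀ n : ℕ, coeff (n + 1) (D ^ 3) * ((n : ℚ) + 1) =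
      (8 * (n : ℚ) - 12) * coeff n (D ^ 3) := by
    intro n
    have h := congrArg (coeff n) hdiff
    rw [show (-12 : ℚ⟦X⟧) = C (-12) by rw [map_neg, map_ofNat], h8, coeff_C_mul, sub_mul, one_mul, mul_assoc,
      map_sub, coeff_C_mul, coeff_derivative] at h
    rcases n with _ | n
    · rw [coeff_zero_X_mul] at h
      push_cast at h ⊢
      linarith
    · rw [coeff_succ_X_mul, coeff_derivative] at h
      push_cast at h ⊢
      linarith
  have h1 : coeff 1 (D ^ 3) = -12 := by
    have := hrec 0
    rw [h0] at this
    simpa using this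
  refine ⟨D ^ 3, hDS, h0, h1, fun j => ?_⟩
  · induction j with
    | zero =>
      have := hrec 1
      rw [h1] at this
      norm_num at this ⊢
      linarith
    | succ j ih =>
      have h := hrec (j + 2)
      rw [ih] at h
      have hj : ((j : ℚ) + 3) ≠ 0 := by positivity
      have h' : coeff (j + 2 + 1) (D ^ 3) = (8 * ((j + 2 : ℕ) : ℚ) - 12) *
          (3 * 2 ^ (j + 4) * ((2 * j)! : ℕ) / (((j + 2)! : ℕ) * (j ! : ℕ))) / (j + 3) := by
        rw [eq_div_iff hj, ← h]; push_cast; ring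
      rw [show j + 1 + 2 = j + 2 + 1 by ring, h', show 2 * (j + 1) = 2 * j + 1 + 1 by ring,
        Nat.factorial_succ (2 * j + 1), Nat.factorial_succ (2 * j), Nat.factorial_succ (j + 2),
        Nat.factorial_succ j]
      have e1 : ((j ! : ℕ) : ℚ) ≠ 0 := by positivity
      have e2 : (((j + 2)! : ℕ) : ℚ) ≠ 0 := by positivity
      push_cast
      field_simp
      ring

/-- The coefficients of `(1 + x)⁻³`. -/
lemma one_add_X_pow_three_mul :
    (1 + X : ℚ⟦X⟧) ^ 3 * mk (fun m => ((m + 2).choose 2 : ℚ) * (-1) ^ m) = 1 := by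
  have h := congrArg (rescale (-1 : ℚ)) (mk_add_choose_mul_one_sub_pow_eq_one ℚ 2)
  rw [map_mul, map_pow, map_sub, map_one, rescale_X, map_neg, map_one, rescale_mk] at h
  have e : (mk fun n => ((-1 : ℚ)) ^ n * ((2 + n).choose 2 : ℚ)) =
      mk fun m => ((m + 2).choose 2 : ℚ) * (-1) ^ m := by
    ext n; simp [mul_comm, add_comm]
  rw [e] at h
  linear_combination h

lemma numerator_mul_inverse (n : ℕ) :
    coeff n ((1 + 4 * X - 4 * X ^ 2 : ℚ⟦X⟧) * mk (fun m => ((m + 2).choose 2 : ℚ) * (-1) ^ m)) =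
      (7 * (n : ℚ) ^ 2 - 3 * n - 2) / 2 * (-1 : ℚ) ^ ((n : ℤ) - 1) := by
  have h4 : (4 : ℚ⟦X⟧) = C 4 := (map_ofNat C 4).symm
  rw [zpow_sub₀ (by norm_num), zpow_natCast, zpow_one, sub_mul, add_mul, one_mul, mul_assoc,
    mul_assoc, pow_two, mul_assoc, h4, map_sub, map_add, coeff_C_mul, coeff_C_mul]
  rcases n with _ | _ | n
  · simp
  · rw [coeff_succ_X_mul, coeff_succ_X_mul]
    simp [Nat.choose]
    norm_num
  · rw [coeff_succ_X_mul, coeff_succ_X_mul, coeff_succ_X_mul]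
    simp only [coeff_mk, Nat.cast_choose_two]
    push_cast
    ring

end Solution

theorem mainTheorem3 (n : ℕ) :
    (numAvoiding n pattern1342 : ℚ) =
      (7 * (n : ℚ) ^ 2 - 3 * (n : ℚ) - 2) / 2 * (-1 : ℚ) ^ ((n : ℤ) - 1) +
        3 * ∑ i ∈ Finset.Icc 2 n,
          (2 : ℚ) ^ (i + 1) * (((2 * i - 4)! : ℕ) : ℚ) / (((i ! : ℕ) : ℚ) * (((i - 2)! : ℕ) : ℚ)) *
            ((Nat.choose (n - i + 2) 2 : ℕ) : ℚ) * (-1 : ℚ) ^ (n - i) := by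
  obtain ⟨R, hR, h0, h1, hj⟩ := exists_sqrt_cube
  set I : PowerSeries ℚ := PowerSeries.mk fun m => ((m + 2).choose 2 : ℚ) * (-1) ^ m with hI
  have hinv : (1 + PowerSeries.X) ^ 3 * I = 1 := one_add_X_pow_three_mul
  set Q : PowerSeries ℚ := PowerSeries.mk fun i => if i < 2 then 0 else PowerSeries.coeff i R
    with hQ
  have hRQ : R = 1 - 12 * PowerSeries.X + Q := by
    have h12 : (12 : PowerSeries ℚ) = PowerSeries.C 12 := (map_ofNat PowerSeries.C 12).symm
    ext i
    rw [h12, map_add, map_sub, PowerSeries.coeff_C_mul, hQ, PowerSeries.coeff_mk]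
    rcases i with _ | _ | i
    · simp [h0]
    · simp [h1, PowerSeries.coeff_one]
    · simp [PowerSeries.coeff_one, PowerSeries.coeff_X]
  have hS : 2 * avoiderSeries =
      2 * ((1 + 4 * PowerSeries.X - 4 * PowerSeries.X ^ 2) * I) + Q * I := by
    linear_combination (-2 * avoiderSeries) * hinv + I * hR + I * hRQ
  have h2 : (2 : PowerSeries ℚ) = PowerSeries.C 2 := (map_ofNat PowerSeries.C 2).symm
  have h := congrArg (PowerSeries.coeff n) hS
  rw [h2, map_add, PowerSeries.coeff_C_mul, PowerSeries.coeff_C_mul, numerator_mul_inverse,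
    PowerSeries.coeff_mul, avoiderSeries, PowerSeries.coeff_mk,
    ← numAvoiding_eq_length_walks, Finset.Nat.sum_antidiagonal_eq_sum_range_succ_mk] at h
  have hsum : ∑ i ∈ Finset.range n.succ, PowerSeries.coeff i Q * PowerSeries.coeff (n - i) I =
      2 * (3 * ∑ i ∈ Finset.Icc 2 n,
          (2 : ℚ) ^ (i + 1) * (((2 * i - 4)! : ℕ) : ℚ) / (((i ! : ℕ) : ℚ) * (((i - 2)! : ℕ) : ℚ)) *
            ((Nat.choose (n - i + 2) 2 : ℕ) : ℚ) * (-1 : ℚ) ^ (n - i)) := by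
    have hsub : Finset.Icc 2 n ⊆ Finset.range n.succ := by
      intro i hi
      rw [Finset.mem_Icc] at hi
      rw [Finset.mem_range]
      omega
    rw [← Finset.sum_subset hsub, Finset.mul_sum, Finset.mul_sum]
    · refine Finset.sum_congr rfl fun i hi => ?_
      rw [Finset.mem_Icc] at hi
      obtain ⟨j, rfl⟩ := Nat.exists_eq_add_of_le' hi.1
      rw [hQ, hI, PowerSeries.coeff_mk, PowerSeries.coeff_mk, if_neg (by omega), hj,
        show 2 * (j + 2) - 4 = 2 * j by omega, Nat.add_sub_cancel]
      ring
    · intro i hi hi'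
      rw [Finset.mem_range] at hi
      rw [Finset.mem_Icc] at hi'
      rw [hQ, PowerSeries.coeff_mk, if_pos (by omega), zero_mul]
  rw [hsum] at h
  linarith
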